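/- **Setting.** Let $\mathcal X,\mathcal U,\mathcal Y$ be complex Hilbert spaces; inner products and duality pairings are linear in the first argument, and $\mathcal H^*$ denotes the anti-dual of $\mathcal H$. Let $\left[\begin{smallmatrix}A\&B\\ C\&D\end{smallmatrix}\right]$ be a system node on $(\mathcal X,\mathcal U,\mathcal Y)$, that is: $A\&B:\mathcal X\times\mathcal U\supset\operatorname{dom}(A\&B)\to\mathcal X$ is a closed linear operator; $C\&D:\operatorname{dom}(A\&B)\to\mathcal Y$ is linear and bounded with respect to the graph norm of $A\&B$; for every $u\in\mathcal U$ there is $x\in\mathcal X$ with $(x,u)\in\operatorname{dom}(A\&B)$; and the operator $x\mapsto A\&B(x,0)$ with domain $\{x:(x,0)\in\operatorname{dom}(A\&B)\}$ generates a strongly continuous semigroup on $\mathcal X$. A *classical trajectory* on $[0,T]$ is a triple $(x,u,y)\in C^1([0,T];\mathcal X)\times C([0,T];\mathcal U)\times C([0,T];\mathcal Y)$ such that for all $t\in[0,T]$: $(x(t),u(t))\in\operatorname{dom}(A\&B)$, $\dot x(t)=A\&B(x(t),u(t))$ and $y(t)=C\&D(x(t),u(t))$ (one-sided derivatives at the end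 points). Let $\mathcal V=\{x\in\mathcal X:\exists u\in\mathcal U,\ (x,u)\in\operatorname{dom}(A\&B)\}$ with the norm $\|x\|_{\mathcal V}=\inf\{(\|x\|^2+\|u\|^2+\|A\&B(x,u)\|^2)^{1/2}: (x,u)\in\operatorname{dom}(A\&B)\}$. Let $Q=Q^*\in L(\mathcal Y)$, $S\in L(\mathcal U,\mathcal Y)$, $R=R^*\in L(\mathcal U)$, and $s(y,u)=\langle y,Qy+Su\rangle+\langle u,S^*y+Ru\rangle$. Let $\mathcal S:\mathcal X\supset\operatorname{dom}(\mathcal S)\to\mathbb R$ be a densely defined, semi-bounded, closed real quadratic form: $\operatorname{dom}(\mathcal S)$ is a dense subspace of $\mathcal X$; the map $h(x,z)=\frac14\big(\mathcal S(x+z)-\mathcal S(x-z)+i\,\mathcal S(x+iz)-i\,\mathcal S(x-iz)\big)$ is sesquilinear on $\operatorname{dom}(\mathcal S)$; and for some sign $\pm$ and some $\lambda\ge0$ the expression $(\pm\mathcal S(x)+\lambda\|x\|^2)^{1/2}$ is a norm on $\operatorname{dom}(\mathcal S)$ for which $\operatorname{dom}(\mathcal S)$ is complete and continuously embedded in $\mathcal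 X$. All norms of this form that give a continuous embedding in $\mathcal X$ are equivalent; $\operatorname{dom}(\mathcal S)$ carries such a norm. Let $\widetilde P\in L(\operatorname{dom}(\mathcal S),\operatorname{dom}(\mathcal S)^*)$ be the operator with $h(x,z)=\langle x,\widetilde Pz\rangle_{\operatorname{dom}(\mathcal S),\operatorname{dom}(\mathcal S)^*}$ for all $x,z\in\operatorname{dom}(\mathcal S)$. Assume that the system is dissipative with respect to the supply rate $s$ and the storage function $\mathcal S$: for all $T>0$ and every classical trajectory $(x,u,y)$ on $[0,T]$ one has $x(0),x(T)\in\operatorname{dom}(\mathcal S)$ and $$\mathcal S(x(T))-\mathcal S(x(0))+\int_0^Ts(y(t),u(t))\,dt\ge0 .$$ **Proposition.** Let $T>0$ and let $(x,u,y)$ be a classical trajectory on $[0,T]$. Then $x(t)\in\operatorname{dom}(\mathcal S)$ for all $t\in[0,T]$, and $t\mapsto\mathcal S(x(t))$ is continuous on $[0,T]$. If, moreover, $x\in C^2([0,T];\mathcal X)$ and $u\in C^1([0,T];\mathcal U)$, then $t\mapsto\mathcal S(x(t))$ is in $C^1([0,T])$. In this case $\mathcal V\subset\operatorname{dom}(\mathcal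 S)$, $\widetilde P$ restricts to a bounded operator from $\mathcal V$ to $\mathcal V^*$ (again denoted $\widetilde P$, with $\langle\widetilde Pv,w\rangle_{\mathcal V^*,\mathcal V}=\langle\widetilde Pv,w\rangle_{\operatorname{dom}(\mathcal S)^*,\operatorname{dom}(\mathcal S)}$ for $v,w\in\mathcal V$), one has $x(t)\in\mathcal V$ and $A\&B(x(t),u(t))\in\mathcal V$ for all $t\in[0,T]$, and $$\forall\,t\in[0,T]:\qquad \tfrac{d}{dt}\mathcal S(x(t))=2\operatorname{Re}\big\langle\widetilde Px(t),A\&B(x(t),u(t))\big\rangle_{\mathcal V^*,\mathcal V}.$$ -/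

import Mathlib

open Set Filter Topology
open scoped ComplexConjugate InnerProductSpace

noncomputable section

/-! ### Strongly continuous semigroups and their generators -/

/-- A strongly continuous semigroup of bounded operators on `X`; only the values at times `t ≥ 0`
are meaningful. -/
structure StronglyContinuousSemigroup (X : Type*) [NormedAddCommGroup X]
    [InnerProductSpace ℂ X] where
  op : ℝ → X →L[ℂ] X
  op_zero : op 0 = ContinuousLinearMap.id ℂ X
  op_add : ∀ s t : ℝ, 0 ≤ s → 0 ≤ t → op (s + t) = (op s).comp (op t)
  strong_cont : ∀ x : X, Tendsto (fun t : ℝ => op t x) (𝓝[>] 0) (𝓝 x)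

/-- `A` is the generator of the semigroup: `x ∈ dom A` with `A x = z` if and only if
`(𝔄(h) x - x) / h → z` as `h ↘ 0`. -/
def StronglyContinuousSemigroup.HasGenerator {X : Type*} [NormedAddCommGroup X]
    [InnerProductSpace ℂ X] (G : StronglyContinuousSemigroup X) (A : X →ₗ.[ℂ] X) : Prop :=
  ∀ x z : X, (x, z) ∈ A.graph ↔
    Tendsto (fun h : ℝ => ((h⁻¹ : ℝ) : ℂ) • (G.op h x - x)) (𝓝[>] 0) (𝓝 z)

/-! ### System nodes -/

section Node

variable {X U Y : Type*}
  [NormedAddCommGroup X] [InnerProductSpace ℂ X]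
  [NormedAddCommGroup U] [InnerProductSpace ℂ U]
  [NormedAddCommGroup Y] [InnerProductSpace ℂ Y]

/-- The graph norm `(‖x‖² + ‖u‖² + ‖A&B (x, u)‖²)^(1/2)` on the domain of an operator
`A&B : X × U ⊇ dom(A&B) → X`. -/
def graphNorm (AB : (X × U) →ₗ.[ℂ] X) (w : AB.domain) : ℝ :=
  Real.sqrt (‖w.1.1‖ ^ 2 + ‖w.1.2‖ ^ 2 + ‖AB w‖ ^ 2)

/-- The main operator `A x = A&B (x, 0)`, with domain `{x | (x, 0) ∈ dom(A&B)}`. -/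
def mainOperator (AB : (X × U) →ₗ.[ℂ] X) : X →ₗ.[ℂ] X where
  domain := AB.domain.comap (LinearMap.inl ℂ X U)
  toFun := AB.toFun.comp
    ((LinearMap.inl ℂ X U).restrict (p := AB.domain.comap (LinearMap.inl ℂ X U))
      (q := AB.domain) (fun _ hx => hx))

variable (X U Y) in
/-- A system node on `(X, U, Y)`. The operators `A&B` and `C&D` have the common domain
`AB.domain`. -/
structure SystemNode where
  AB : (X × U) →ₗ.[ℂ] X
  CD : AB.domain →ₗ[ℂ] Y
  closed : AB.IsClosed
  bounded : ∃ c : ℝ, ∀ w : AB.domain, ‖CD w‖ ≤ c * graphNorm AB w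
  exists_state : ∀ u : U, ∃ x : X, (x, u) ∈ AB.domain
  generates : ∃ G : StronglyContinuousSemigroup X, G.HasGenerator (mainOperator AB)

/-- Classical trajectories on `[0, T]` of `(ẋ, y) = (A&B (x, u), C&D (x, u))`; at the end points
of `[0, T]` derivatives are one-sided. -/
structure SystemNode.IsClassicalTrajectory (N : SystemNode X U Y) (T : ℝ)
    (x : ℝ → X) (u : ℝ → U) (y : ℝ → Y) : Prop where
  contDiffOn_state : ContDiffOn ℝ 1 x (Icc 0 T)
  continuousOn_input : ContinuousOn u (Icc 0 T)
  continuousOn_output : ContinuousOn y (Icc 0 T)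
  equation : ∀ t ∈ Icc 0 T, ∃ hw : (x t, u t) ∈ N.AB.domain,
    HasDerivWithinAt x (N.AB ⟨(x t, u t), hw⟩) (Icc 0 T) t ∧ y t = N.CD ⟨(x t, u t), hw⟩

/-! ### The space `V` of states that are admissible for some input value -/

/-- `V = {x | ∃ u, (x, u) ∈ dom(A&B)}` as a subspace of `X`. -/
def SystemNode.V (N : SystemNode X U Y) : Submodule ℂ X :=
  N.AB.domain.map (LinearMap.fst ℂ X U)

/-- The space `V`, to be equipped with its own norm (not the one inherited from `X`). -/
def SystemNode.VSpace (N : SystemNode X U Y) : Type _ := N.V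

instance (N : SystemNode X U Y) : AddCommGroup N.VSpace := inferInstanceAs (AddCommGroup N.V)

instance (N : SystemNode X U Y) : Module ℂ N.VSpace := inferInstanceAs (Module ℂ N.V)

/-- The underlying vector of `X`. -/
def SystemNode.VSpace.val {N : SystemNode X U Y} (v : N.VSpace) : X := Subtype.val (p := (· ∈ N.V)) v

/-- An element of `X` that lies in `V`, as a point of the normed space `V`. -/
def SystemNode.VSpace.mk {N : SystemNode X U Y} (x : X) (hx : x ∈ N.V) : N.VSpace :=
  (⟨x, hx⟩ : N.V)

theorem SystemNode.VSpace.val_mem {N : SystemNode X U Y} (v : N.VSpace) : v.val ∈ N.V :=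
  Subtype.property (p := (· ∈ N.V)) v

/-- `‖x‖_V = inf {‖(x, u)‖_{dom(A&B)} | u with (x, u) ∈ dom(A&B)}`. -/
instance (N : SystemNode X U Y) : Norm N.VSpace where
  norm v := sInf {r : ℝ | ∃ w : N.AB.domain, w.1.1 = v.val ∧ r = graphNorm N.AB w}

theorem graphNorm_eq (AB : (X × U) →ₗ.[ℂ] X) (w : AB.domain) :
    graphNorm AB w = ‖WithLp.toLp 2 (WithLp.toLp 2 (w.1.1, w.1.2), AB w)‖ := by
  rw [WithLp.prod_norm_eq_of_L2, WithLp.prod_norm_sq_eq_of_L2]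
  rfl

theorem graphNorm_nonneg (AB : (X × U) →ₗ.[ℂ] X) (w : AB.domain) : 0 ≤ graphNorm AB w :=
  Real.sqrt_nonneg _

theorem graphNorm_add_le (AB : (X × U) →ₗ.[ℂ] X) (w z : AB.domain) :
    graphNorm AB (w + z) ≤ graphNorm AB w + graphNorm AB z := by
  simp only [graphNorm_eq]
  refine le_trans (le_of_eq ?_) (norm_add_le _ _)
  congr 1
  rw [← WithLp.toLp_add, Prod.mk_add_mk, ← WithLp.toLp_add, Prod.mk_add_mk, LinearPMap.map_add]
  rfl

theorem graphNorm_smul (AB : (X × U) →ₗ.[ℂ] X) (c : ℂ) (w : AB.domain) :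
    graphNorm AB (c • w) = ‖c‖ * graphNorm AB w := by
  simp only [graphNorm_eq]
  rw [← norm_smul]
  congr 1
  rw [← WithLp.toLp_smul, Prod.smul_mk, ← WithLp.toLp_smul, Prod.smul_mk, LinearPMap.map_smul]
  rfl

theorem norm_fst_le_graphNorm (AB : (X × U) →ₗ.[ℂ] X) (w : AB.domain) :
    ‖w.1.1‖ ≤ graphNorm AB w := by
  apply Real.le_sqrt_of_sq_le
  nlinarith [sq_nonneg ‖w.1.2‖, sq_nonneg ‖AB w‖]

theorem SystemNode.VSpace.norm_le {N : SystemNode X U Y} (v : N.VSpace) (w : N.AB.domain)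
    (hw : w.1.1 = v.val) : ‖v‖ ≤ graphNorm N.AB w :=
  csInf_le ⟨0, by rintro _ ⟨z, _, rfl⟩; exact graphNorm_nonneg _ _⟩ ⟨w, hw, rfl⟩

theorem SystemNode.VSpace.le_norm {N : SystemNode X U Y} (v : N.VSpace) (r : ℝ)
    (h : ∀ w : N.AB.domain, w.1.1 = v.val → r ≤ graphNorm N.AB w) : r ≤ ‖v‖ := by
  apply le_csInf
  · obtain ⟨w, hw, hv⟩ := Submodule.mem_map.1 v.val_mem
    exact ⟨_, ⟨w, hw⟩, hv, rfl⟩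
  · rintro _ ⟨w, hw, rfl⟩
    exact h w hw

theorem SystemNode.VSpace.norm_smul_le {N : SystemNode X U Y} (c : ℂ) (v : N.VSpace) :
    ‖c • v‖ ≤ ‖c‖ * ‖v‖ := by
  by_cases hc : c = 0
  · subst hc
    refine le_trans (norm_le _ 0 ?_) (le_of_eq ?_)
    · simp only [zero_smul]; rfl
    · simpa using graphNorm_smul N.AB 0 0
  · have hc' : 0 < ‖c‖ := norm_pos_iff.2 hc
    rw [← div_le_iff₀' hc']
    refine le_norm v _ fun w hw => ?_
    rw [div_le_iff₀' hc', ← graphNorm_smul]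
    refine norm_le _ _ ?_
    change c • w.1.1 = c • v.val
    rw [hw]

theorem SystemNode.VSpace.core (N : SystemNode X U Y) : NormedSpace.Core ℂ N.VSpace where
  norm_nonneg v := v.le_norm 0 fun w _ => graphNorm_nonneg _ w
  norm_smul c v := by
    refine le_antisymm (norm_smul_le c v) ?_
    by_cases hc : c = 0
    · rw [hc, norm_zero, zero_mul]
      exact le_norm _ 0 fun w _ => graphNorm_nonneg _ w
    · have h := norm_smul_le c⁻¹ (c • v)
      rw [smul_smul, inv_mul_cancel₀ hc, one_smul, norm_inv] at h
      rwa [← le_inv_mul_iff₀ (norm_pos_iff.2 hc)]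
  norm_triangle v w := by
    rw [← sub_le_iff_le_add]
    refine le_norm v _ fun a ha => ?_
    rw [sub_le_iff_le_add, ← sub_le_iff_le_add']
    refine le_norm w _ fun b hb => ?_
    rw [sub_le_iff_le_add']
    refine le_trans (norm_le _ (a + b) ?_) (graphNorm_add_le _ _ _)
    change a.1.1 + b.1.1 = v.val + w.val
    rw [ha, hb]
  norm_eq_zero_iff v := by
    constructor
    · intro h
      have h' : ‖v.val‖ ≤ ‖v‖ := le_norm v _ fun w hw => hw ▸ norm_fst_le_graphNorm _ w
      rw [h] at h'
      exact Subtype.ext (norm_le_zero_iff.1 h')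
    · rintro rfl
      have h := norm_smul_le (N := N) 0 0
      rw [zero_smul, norm_zero, zero_mul] at h
      exact le_antisymm h (le_norm _ 0 fun w _ => graphNorm_nonneg _ w)

instance (N : SystemNode X U Y) : NormedAddCommGroup N.VSpace :=
  NormedAddCommGroup.ofCore (SystemNode.VSpace.core N)

instance (N : SystemNode X U Y) : NormedSpace ℂ N.VSpace :=
  NormedSpace.ofCore (SystemNode.VSpace.core N)

end Node

/-! ### Real quadratic forms -/

/-- The expression `(S(x+z) - S(x-z) + i S(x+iz) - i S(x-iz)) / 4`. -/
def polarForm {E : Type*} [AddCommGroup E] [Module ℂ E] (S : E → ℝ) (x z : E) : ℂ :=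
  (1 / 4 : ℂ) * ((S (x + z) : ℂ) - (S (x - z) : ℂ)
    + Complex.I * (S (x + Complex.I • z) : ℂ) - Complex.I * (S (x - Complex.I • z) : ℂ))

/-- A real quadratic form in `X` with domain `dom`: its polar form is sesquilinear (linear in the
first and conjugate linear in the second argument). -/
structure RealQuadraticForm (X : Type*) [NormedAddCommGroup X] [InnerProductSpace ℂ X] where
  dom : Submodule ℂ X
  toFun : dom → ℝ
  sesquilinear : ∃ h : dom →ₗ[ℂ] dom →ₗ⋆[ℂ] ℂ, ∀ x z, h x z = polarForm toFun x z

namespace RealQuadraticForm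

variable {X : Type*} [NormedAddCommGroup X] [InnerProductSpace ℂ X]

open Classical in
/-- The value of the form at a vector of its domain (and `0` at any other vector). -/
def value (S : RealQuadraticForm X) (x : X) : ℝ :=
  if hx : x ∈ S.dom then S.toFun ⟨x, hx⟩ else 0

/-- A choice of a sign `ε = ±1` and of `lam ≥ 0` such that `x ↦ (ε S(x) + lam ‖x‖²)^(1/2)` is a
norm on the domain of `S`, and the domain with this norm is continuously embedded in `X`. The
embedding holds automatically after enlarging `lam`, and any two such norms on the domain are
equivalent. The form is semi-bounded if and only if such a choice exists. -/
structure FormNorm (S : RealQuadraticForm X) where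
  ε : ℝ
  sign : ε = 1 ∨ ε = -1
  lam : ℝ
  lam_nonneg : 0 ≤ lam
  norm : Seminorm ℂ S.dom
  norm_sq : ∀ x : S.dom, norm x ^ 2 = ε * S.toFun x + lam * ‖(x : X)‖ ^ 2
  embed : ∃ c : ℝ, ∀ x : S.dom, ‖(x : X)‖ ≤ c * norm x

/-- The domain of `S`, to be equipped with the norm `n`. -/
def FormNorm.Space {S : RealQuadraticForm X} (_ : S.FormNorm) : Type _ := S.dom

section Space

variable {S : RealQuadraticForm X} (n : S.FormNorm)

instance : AddCommGroup n.Space := inferInstanceAs (AddCommGroup S.dom)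

instance : Module ℂ n.Space := inferInstanceAs (Module ℂ S.dom)

/-- An element of the domain of `S` as a point of the normed space `dom S`. -/
def FormNorm.pt (x : S.dom) : n.Space := x

instance : Norm n.Space where
  norm x := n.norm x

theorem FormNorm.core : NormedSpace.Core ℂ n.Space where
  norm_nonneg x := apply_nonneg n.norm x
  norm_smul c x := map_smul_eq_mul n.norm c x
  norm_triangle x z := map_add_le_add n.norm x z
  norm_eq_zero_iff x := by
    constructor
    · intro h
      obtain ⟨c, hc⟩ := n.embed
      have h0 : n.norm x = 0 := h
      have h1 := hc x
      rw [h0, mul_zero] at h1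
      exact Subtype.ext (norm_le_zero_iff.1 h1)
    · rintro rfl
      exact map_zero n.norm

instance : NormedAddCommGroup n.Space := NormedAddCommGroup.ofCore n.core

instance : NormedSpace ℂ n.Space := NormedSpace.ofCore n.core

end Space

/-- `S` is semi-bounded and closed: its domain is complete with respect to the norm
`(± S(x) + lam ‖x‖²)^(1/2)`. -/
def IsClosedSemibounded (S : RealQuadraticForm X) : Prop :=
  ∃ n : S.FormNorm, CompleteSpace n.Space

/-- `P : dom S → (dom S)*` (anti-dual) is the bounded operator representing the polar form `h`:
`h(x, z) = ⟨x, P z⟩`, where `⟨x, f⟩` is the conjugate of the value `f x = ⟨f, x⟩`. -/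
def FormNorm.Represents {S : RealQuadraticForm X} (n : S.FormNorm)
    (P : n.Space →L[ℂ] (n.Space →L⋆[ℂ] ℂ)) : Prop :=
  ∀ x z : S.dom, polarForm S.toFun x z = conj (P (n.pt z) (n.pt x))

theorem FormNorm.toFun_smul {S : RealQuadraticForm X} (n : S.FormNorm) (a : ℂ) (x : S.dom) :
    S.toFun (a • x) = ‖a‖ ^ 2 * S.toFun x := by
  have h1 := n.norm_sq (a • x)
  have h2 := n.norm_sq x
  rw [map_smul_eq_mul, mul_pow, h2, Submodule.coe_smul, norm_smul, mul_pow] at h1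
  rcases n.sign with h | h <;> rw [h] at h1 <;> linarith

theorem FormNorm.polarForm_conj {S : RealQuadraticForm X} (n : S.FormNorm) (x z : S.dom) :
    polarForm S.toFun x z = conj (polarForm S.toFun z x) := by
  have h1 : S.toFun (x - z) = S.toFun (z - x) := by
    have := n.toFun_smul (-1) (z - x)
    simpa using this
  have h2 : S.toFun (x + Complex.I • z) = S.toFun (z - Complex.I • x) := by
    have := n.toFun_smul Complex.I (z - Complex.I • x)
    rw [smul_sub, smul_smul, Complex.I_mul_I] at this
    simpa [add_comm] using this
  have h3 : S.toFun (x - Complex.I • z) = S.toFun (z + Complex.I • x) := by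
    have := n.toFun_smul (-Complex.I) (z + Complex.I • x)
    rw [smul_add, smul_smul, neg_mul, Complex.I_mul_I] at this
    simpa [add_comm, sub_eq_add_neg] using this
  simp only [polarForm, map_mul, map_add, map_sub, Complex.conj_ofReal, Complex.conj_I, map_div₀,
    map_one, map_ofNat, h1, h2, h3, add_comm z x]
  ring

theorem FormNorm.norm_polarForm_le {S : RealQuadraticForm X} (n : S.FormNorm) :
    ∃ C : ℝ, ∀ x z : S.dom, ‖polarForm S.toFun x z‖ ≤ C * n.norm x * n.norm z := by
  obtain ⟨c, hc⟩ := n.embed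
  obtain ⟨B, hB⟩ := S.sesquilinear
  have hlam := n.lam_nonneg
  have hS : ∀ w : S.dom, |S.toFun w| ≤ (1 + n.lam * c ^ 2) * n.norm w ^ 2 := by
    intro w
    have h1 := n.norm_sq w
    have h2 : ‖(w : X)‖ ^ 2 ≤ c ^ 2 * n.norm w ^ 2 := by
      rw [← mul_pow]
      exact pow_le_pow_left₀ (norm_nonneg _) (hc w) 2
    have h3 := mul_le_mul_of_nonneg_left h2 hlam
    have h4 : 0 ≤ n.lam * ‖(w : X)‖ ^ 2 := by positivity
    have h5 : 0 ≤ n.norm w ^ 2 := by positivity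
    rw [abs_le]
    rcases n.sign with h | h <;> rw [h] at h1 <;> constructor <;> nlinarith
  set K := 1 + n.lam * c ^ 2 with hK
  have hK0 : 0 ≤ K := by positivity
  have hb : ∀ x z : S.dom, n.norm x ≤ 1 → n.norm z ≤ 1 → ‖B x z‖ ≤ 4 * K := by
    intro x z hx hz
    have hI : n.norm (Complex.I • z) = n.norm z := by rw [map_smul_eq_mul]; simp
    have key : ∀ w : S.dom, n.norm w ≤ 2 → |S.toFun w| ≤ 4 * K := by
      intro w hw
      have h0 : 0 ≤ n.norm w := apply_nonneg _ _
      have : n.norm w ^ 2 ≤ 4 := by nlinarith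
      nlinarith [hS w]
    have k1 := key (x + z) ((map_add_le_add _ _ _).trans (by linarith))
    have k2 := key (x - z) ((map_sub_le_add _ _ _).trans (by linarith))
    have k3 := key (x + Complex.I • z) ((map_add_le_add _ _ _).trans (by linarith))
    have k4 := key (x - Complex.I • z) ((map_sub_le_add _ _ _).trans (by linarith))
    have e : ∀ r : ℝ, ‖(r : ℂ)‖ = |r| := fun r => by simp
    have e' : ∀ r : ℝ, ‖Complex.I * (r : ℂ)‖ = |r| := fun r => by simp
    rw [hB, polarForm, norm_mul]
    have h4 : ‖(1 / 4 : ℂ)‖ = 1 / 4 := by norm_num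
    rw [h4]
    have t1 := norm_sub_le ((S.toFun (x + z) : ℂ) - (S.toFun (x - z) : ℂ)
      + Complex.I * (S.toFun (x + Complex.I • z) : ℂ))
      (Complex.I * (S.toFun (x - Complex.I • z) : ℂ))
    have t2 := norm_add_le ((S.toFun (x + z) : ℂ) - (S.toFun (x - z) : ℂ))
      (Complex.I * (S.toFun (x + Complex.I • z) : ℂ))
    have t3 := norm_sub_le (S.toFun (x + z) : ℂ) (S.toFun (x - z) : ℂ)
    simp only [e, e'] at t1 t2 t3
    linarith
  have hz0 : ∀ x : S.dom, n.norm x = 0 → x = 0 := fun x hx => (n.core.norm_eq_zero_iff x).1 hx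
  refine ⟨4 * K, fun x z => ?_⟩
  rw [← hB]
  by_cases hx : n.norm x = 0
  · rw [hz0 x hx]; simp
  by_cases hz : n.norm z = 0
  · rw [hz0 z hz]; simp
  have hx' : 0 < n.norm x := lt_of_le_of_ne (apply_nonneg _ _) (Ne.symm hx)
  have hz' : 0 < n.norm z := lt_of_le_of_ne (apply_nonneg _ _) (Ne.symm hz)
  have hn : ∀ w : S.dom, 0 < n.norm w → n.norm (((n.norm w)⁻¹ : ℂ) • w) ≤ 1 := by
    intro w hw
    rw [map_smul_eq_mul, norm_inv, Complex.norm_real, Real.norm_of_nonneg hw.le,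
      inv_mul_cancel₀ hw.ne']
  have h := hb _ _ (hn x hx') (hn z hz')
  rw [LinearMap.map_smulₛₗ, LinearMap.map_smul B, LinearMap.smul_apply, norm_smul, norm_smul,
    RCLike.norm_conj, mul_left_comm, ← mul_assoc, norm_inv, norm_inv, Complex.norm_real, Complex.norm_real, Real.norm_of_nonneg hx'.le,
    Real.norm_of_nonneg hz'.le, ← mul_inv,
    inv_mul_le_iff₀ (mul_pos hx' hz')] at h
  linarith

/-- The representing operator exists and is unique. -/
theorem FormNorm.existsUnique_represents {S : RealQuadraticForm X} (n : S.FormNorm) :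
    ∃! P : n.Space →L[ℂ] (n.Space →L⋆[ℂ] ℂ), n.Represents P := by
  obtain ⟨B, hB⟩ := S.sesquilinear
  obtain ⟨C, hC⟩ := n.norm_polarForm_le
  let B' : n.Space →ₗ[ℂ] n.Space →ₗ⋆[ℂ] ℂ := B
  refine ⟨B'.mkContinuous₂ C fun x z => ?_, fun x z => ?_, fun P hP => ?_⟩
  · have h := hC x z
    rw [← hB x z] at h
    exact h
  · have h := n.polarForm_conj x z
    rw [← hB z x] at h
    exact h
  · ext z x
    have h := (n.polarForm_conj x z).symm.trans (hP x z)
    rw [← hB z x] at h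
    exact ((starRingEnd ℂ).injective h).symm

end RealQuadraticForm

/-! ### Dissipativity -/

section Dissipativity

variable {X U Y : Type*}
  [NormedAddCommGroup X] [InnerProductSpace ℂ X]
  [NormedAddCommGroup U] [InnerProductSpace ℂ U] [CompleteSpace U]
  [NormedAddCommGroup Y] [InnerProductSpace ℂ Y] [CompleteSpace Y]

/-- The supply rate `s(y, u) = ⟨(y, u), (Q y + S u, S* y + R u)⟩`, which is real for self-adjoint
`Q` and `R`. -/
def supplyRate (Q : Y →L[ℂ] Y) (S : U →L[ℂ] Y) (R : U →L[ℂ] U) (y : Y) (u : U) : ℝ :=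
  (⟪y, Q y + S u⟫_ℂ + ⟪u, ContinuousLinearMap.adjoint S y + R u⟫_ℂ).re

/-- The system is dissipative with respect to the supply rate `s` and the storage function `St`. -/
def SystemNode.IsDissipative (N : SystemNode X U Y) (s : Y → U → ℝ)
    (St : RealQuadraticForm X) : Prop :=
  ∀ (T : ℝ), 0 < T → ∀ (x : ℝ → X) (u : ℝ → U) (y : ℝ → Y), N.IsClassicalTrajectory T x u y →
    x 0 ∈ St.dom ∧ x T ∈ St.dom ∧
      0 ≤ St.value (x T) - St.value (x 0) + ∫ t in (0 : ℝ)..T, s (y t) (u t)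

end Dissipativity

end

/-! Two facts carry the proof. The first is `V ⊆ dom S`. For `(x₀, u₀) ∈ dom(A&B)` and `b = A&B(x₀,
u₀)`, the curve `x(t) = x₀ + ∫₀ᵗ 𝔄(s)b ds` with constant input `u₀` is a classical trajectory,
because `∫₀ᵗ 𝔄(s)b ds` lies in the domain of the generator, which sends it to `𝔄(t)b - b`.
Dissipativity then puts `x(0) = x₀` in `dom S` (`exists_isClassicalTrajectory`,
`IsDissipative.V_le_dom`).

The second is the closed graph theorem: the projection `J` from the graph of `A&B`, a Banach space,
to `dom S` with its form norm is bounded (`exists_clm_graph`). Every classical trajectory lifts to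
the continuous curve `g = ((x, u), ẋ)` in that graph, and `S(x(t)) = Re P(J g(t), J g(t))` is a
bounded real-bilinear form evaluated along it, hence continuous in `t`.

If `x` is `C²` and `u` is `C¹`, then `g` is `C¹`. Its derivative `((ẋ, u̇), ẍ)` stays in the graph
because the graph is closed. Hence `ẋ = A&B(x, u) ∈ V`, and the product rule with the symmetry of
`Re P` gives the formula. -/

/-! ### Strong continuity of the semigroup, and integrals of orbits. -/

namespace StronglyContinuousSemigroup

variable {X : Type*} [NormedAddCommGroup X] [InnerProductSpace ℂ X]
  (G : StronglyContinuousSemigroup X)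

theorem tendsto_op_zero (b : X) : Tendsto (fun t => G.op t b) (𝓝[≥] 0) (𝓝 b) := by
  have h : ContinuousWithinAt (fun t => G.op t b) (Ioi 0) 0 := by
    have := G.strong_cont b
    simpa [ContinuousWithinAt, G.op_zero] using this
  have h' := (continuousWithinAt_insert_self.2 h)
  rw [Ioi_insert] at h'
  simpa [ContinuousWithinAt, G.op_zero] using h'

theorem op_add_apply {s t : ℝ} (hs : 0 ≤ s) (ht : 0 ≤ t) (b : X) :
    G.op (s + t) b = G.op s (G.op t b) := by
  rw [G.op_add s t hs ht]; rfl

/-- The orbit of `b`, extended by the constant `b` to negative times. -/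
def orbit (b : X) (t : ℝ) : X := G.op (max 0 t) b

theorem orbit_of_nonneg (b : X) {t : ℝ} (ht : 0 ≤ t) : G.orbit b t = G.op t b := by
  rw [orbit, max_eq_right ht]

theorem orbit_zero (b : X) : G.orbit b 0 = b := by
  rw [orbit_of_nonneg _ _ le_rfl, G.op_zero]; rfl

variable [CompleteSpace X]

theorem exists_bound_near_zero : ∃ δ > 0, ∃ M : ℝ, ∀ t ∈ Icc 0 δ, ‖G.op t‖ ≤ M := by
  by_contra! hcon
  have hpos : ∀ k : ℕ, (0 : ℝ) < 1 / ((k : ℝ) + 1) := fun k => Nat.one_div_pos_of_nat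
  -- Unboundedness on each `[0, 1/(k+1)]` yields times `τ k → 0` with `‖𝔄(τ k)‖ > k`. Strong
  -- continuity at `0` makes this sequence pointwise bounded, which contradicts uniform boundedness.
  choose τ hτ hM using fun k : ℕ => hcon _ (hpos k) k
  have hlim : Tendsto τ atTop (𝓝[≥] 0) :=
    tendsto_nhdsWithin_iff.2 ⟨squeeze_zero (fun k => (hτ k).1) (fun k => (hτ k).2)
      tendsto_one_div_add_atTop_nhds_zero_nat, Eventually.of_forall fun k => (hτ k).1⟩
  obtain ⟨C, hC⟩ := banach_steinhaus (g := fun k => G.op (τ k)) fun b => by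
    obtain ⟨C, hC⟩ := ((G.tendsto_op_zero b).comp hlim).norm.bddAbove_range
    exact ⟨C, fun k => hC ⟨k, rfl⟩⟩
  obtain ⟨k, hk⟩ := exists_nat_gt C
  exact absurd (hC k) (not_le.2 (hk.trans (hM k)))

/-- Right continuity follows from `𝔄(s) = 𝔄(t)𝔄(s - t)`. From the left, `𝔄(s)b - 𝔄(t)b = 𝔄(s)(b -
𝔄(t - s)b)`, which requires a bound on `‖𝔄(s)‖` uniform in `s` near `t`. -/
theorem continuousOn_op (b : X) : ContinuousOn (fun t => G.op t b) (Ici 0) := by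
  obtain ⟨δ, hδ, M, hM⟩ := G.exists_bound_near_zero
  intro t ht
  have ht : 0 ≤ t := ht
  rw [← Icc_union_Ici_eq_Ici ht]
  refine ContinuousWithinAt.union ?_ ?_
  -- The window `[a, t]` has length at most `δ`, so there `𝔄(s) = 𝔄(s - a)𝔄(a)` is bounded by `M
  -- ‖𝔄(a)‖`.
  · set a := max 0 (t - δ) with ha
    have ha0 : 0 ≤ a := le_max_left _ _
    have hbd : ∀ s ∈ Icc a t, ‖G.op s‖ ≤ M * ‖G.op a‖ := by
      intro s hs
      have hsδ : s - a ≤ δ := by linarith [hs.2, le_max_right 0 (t - δ)]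
      have h := G.op_add (s - a) a (sub_nonneg.2 hs.1) ha0
      rw [sub_add_cancel] at h
      rw [h]
      refine (ContinuousLinearMap.opNorm_comp_le _ _).trans ?_
      gcongr
      exact hM _ ⟨sub_nonneg.2 hs.1, hsδ⟩
    have hsub : Tendsto (fun s => t - s) (𝓝[Icc 0 t] t) (𝓝[≥] 0) := by
      refine tendsto_nhdsWithin_iff.2 ⟨?_, ?_⟩
      · have : Tendsto (fun s => t - s) (𝓝 t) (𝓝 (t - t)) := by
          exact (continuous_const.sub continuous_id).tendsto t
        rw [sub_self] at this
        exact this.mono_left nhdsWithin_le_nhds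
      · filter_upwards [self_mem_nhdsWithin] with s hs using sub_nonneg.2 hs.2
    have h0 : Tendsto (fun s => M * ‖G.op a‖ * ‖G.op (t - s) b - b‖) (𝓝[Icc 0 t] t) (𝓝 0) := by
      have := (((G.tendsto_op_zero b).comp hsub).sub_const b).norm.const_mul (M * ‖G.op a‖)
      simpa using this
    have hev : ∀ᶠ s in 𝓝[Icc 0 t] t, a ≤ s := by
      rcases ht.eq_or_lt with rfl | ht'
      · filter_upwards [self_mem_nhdsWithin] with s hs
        rw [ha, max_eq_left (by linarith)]
        exact hs.1
      · have : a < t := max_lt ht' (by linarith)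
        filter_upwards [mem_nhdsWithin_of_mem_nhds (lt_mem_nhds this)] with s hs using hs.le
    rw [ContinuousWithinAt, tendsto_iff_norm_sub_tendsto_zero]
    refine squeeze_zero' (Eventually.of_forall fun _ => norm_nonneg _) ?_ h0
    filter_upwards [hev, self_mem_nhdsWithin] with s hs hs'
    have h := G.op_add_apply (ha0.trans hs) (sub_nonneg.2 hs'.2) b
    rw [add_sub_cancel] at h
    rw [h, norm_sub_rev, ← map_sub]
    exact (ContinuousLinearMap.le_opNorm _ _).trans (by gcongr; exact hbd s ⟨hs, hs'.2⟩)
  · have hsub : Tendsto (fun s => s - t) (𝓝[Ici t] t) (𝓝[≥] 0) := by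
      refine tendsto_nhdsWithin_iff.2 ⟨?_, ?_⟩
      · have : Tendsto (fun s => s - t) (𝓝 t) (𝓝 (t - t)) :=
          (continuous_id.sub continuous_const).tendsto t
        rw [sub_self] at this
        exact this.mono_left nhdsWithin_le_nhds
      · filter_upwards [self_mem_nhdsWithin] with s hs using sub_nonneg.2 (mem_Ici.1 hs)
    have h := ((G.op t).continuous.tendsto b).comp ((G.tendsto_op_zero b).comp hsub)
    refine h.congr' ?_
    filter_upwards [self_mem_nhdsWithin] with s hs
    have h := G.op_add_apply ht (sub_nonneg.2 (mem_Ici.1 hs)) b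
    rw [add_sub_cancel] at h
    exact h.symm

theorem continuous_orbit (b : X) : Continuous (G.orbit b) :=
  (G.continuousOn_op b).comp_continuous (continuous_const.max continuous_id)
    fun t => mem_Ici.2 (le_max_left 0 t)

theorem hasDerivAt_integral_orbit (b : X) (t : ℝ) :
    HasDerivAt (fun r => ∫ s in (0 : ℝ)..r, G.orbit b s) (G.orbit b t) t :=
  intervalIntegral.integral_hasDerivAt_right ((G.continuous_orbit b).intervalIntegrable _ _)
    ((G.continuous_orbit b).stronglyMeasurableAtFilter _ _) (G.continuous_orbit b).continuousAt

/-- Shifting the integral by `h` gives `𝔄(h)∫₀ᵗ - ∫₀ᵗ = ∫ₜᵗ⁺ʰ - ∫₀ʰ`. Divided by `h`, the right side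
is a difference of two difference quotients of the primitive of the orbit, at `t` and at `0`. -/
theorem HasGenerator.integral_orbit_mem_graph {G : StronglyContinuousSemigroup X} {A : X →ₗ.[ℂ] X}
    (hA : G.HasGenerator A) (b : X) {t : ℝ} (ht : 0 ≤ t) :
    (∫ s in (0 : ℝ)..t, G.orbit b s, G.orbit b t - b) ∈ A.graph := by
  rw [hA]
  have hint := fun r s => (G.continuous_orbit b).intervalIntegrable (μ := MeasureTheory.volume) r s
  have key : ∀ h > 0, G.op h (∫ s in (0 : ℝ)..t, G.orbit b s) =
      (∫ s in (0 : ℝ)..(t + h), G.orbit b s) - ∫ s in (0 : ℝ)..(0 + h), G.orbit b s := by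
    intro h hh
    rw [intervalIntegral.integral_interval_sub_left (hint _ _) (hint _ _),
      ← intervalIntegral.integral_comp_add_right,
      ← ContinuousLinearMap.intervalIntegral_comp_comm _ (hint _ _)]
    refine intervalIntegral.integral_congr fun s hs => ?_
    rw [uIcc_of_le ht] at hs
    change G.op h (G.orbit b s) = G.orbit b (s + h)
    rw [orbit_of_nonneg _ _ hs.1, orbit_of_nonneg _ _ (add_nonneg hs.1 hh.le), add_comm,
      G.op_add_apply hh.le hs.1]
  have h1 := (G.hasDerivAt_integral_orbit b t).tendsto_slope_zero_right
  have h2 := (G.hasDerivAt_integral_orbit b 0).tendsto_slope_zero_right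
  rw [orbit_zero] at h2
  refine (h1.sub h2).congr' ?_
  filter_upwards [self_mem_nhdsWithin] with h hh
  rw [key h hh, Complex.coe_smul, ← smul_sub, intervalIntegral.integral_same, sub_zero,
    sub_right_comm]

end StronglyContinuousSemigroup

/-! ### Trajectories through given points, and the embedding of `V` into `dom S`. -/

namespace SystemNode

variable {X U Y : Type*}
  [NormedAddCommGroup X] [InnerProductSpace ℂ X]
  [NormedAddCommGroup U] [InnerProductSpace ℂ U]
  [NormedAddCommGroup Y] [InnerProductSpace ℂ Y]

theorem norm_CD_sub_le {N : SystemNode X U Y} {c : ℝ}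
    (hc : ∀ w : N.AB.domain, ‖N.CD w‖ ≤ c * graphNorm N.AB w) (w z : N.AB.domain) :
    ‖N.CD w - N.CD z‖ ≤
      c * Real.sqrt (‖w.1.1 - z.1.1‖ ^ 2 + ‖w.1.2 - z.1.2‖ ^ 2 + ‖N.AB w - N.AB z‖ ^ 2) := by
  rw [← map_sub, ← LinearPMap.map_sub]
  exact hc (w - z)

/-- Every point of the domain is the initial value of a classical trajectory with constant
input. -/
theorem exists_isClassicalTrajectory [CompleteSpace X] (N : SystemNode X U Y) (T : ℝ)
    (w : N.AB.domain) :
    ∃ (x : ℝ → X) (u : ℝ → U) (y : ℝ → Y), N.IsClassicalTrajectory T x u y ∧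
      x 0 = w.1.1 := by
  classical
  obtain ⟨G, hG⟩ := N.generates
  set b := N.AB w with hb
  -- Since `(x(t), u₀) = w + (z(t), 0)`, the value of `A&B` there is `b + (𝔄(t)b - b) = 𝔄(t)b`,
  -- which is `ẋ(t)`.
  let z : ℝ → X := fun t => ∫ s in (0 : ℝ)..t, G.orbit b s
  let x : ℝ → X := fun t => w.1.1 + z t
  have hx : ∀ t, HasDerivAt x (G.orbit b t) t := fun t =>
    (G.hasDerivAt_integral_orbit b t).const_add _
  have hmem : ∀ t, 0 ≤ t → ∃ h : (x t, w.1.2) ∈ N.AB.domain,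
      N.AB ⟨(x t, w.1.2), h⟩ = G.orbit b t := by
    intro t ht
    obtain ⟨a, ha1, ha2⟩ := (LinearPMap.mem_graph_iff _).1 (hG.integral_orbit_mem_graph b ht)
    have ha : ((a : X), (0 : U)) ∈ N.AB.domain := a.2
    have ha2' : N.AB ⟨((a : X), (0 : U)), ha⟩ = G.orbit b t - b := ha2
    have ha1 : (a : X) = z t := ha1
    have hsum : (x t, w.1.2) = ((w + ⟨((a : X), (0 : U)), ha⟩ : N.AB.domain) : X × U) := by
      refine Prod.ext ?_ ?_
      · change w.1.1 + z t = w.1.1 + a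
        rw [ha1]
      · change w.1.2 = w.1.2 + 0
        rw [add_zero]
    have hd : (x t, w.1.2) ∈ N.AB.domain := by rw [hsum]; exact Subtype.property _
    refine ⟨hd, ?_⟩
    have : (⟨(x t, w.1.2), hd⟩ : N.AB.domain) = w + ⟨((a : X), (0 : U)), ha⟩ := Subtype.ext hsum
    rw [this, LinearPMap.map_add, ha2', ← hb, add_sub_cancel]
  -- The default `0` plays no role for `t ≥ 0`, where `hmem` supplies membership in the domain.
  let y : ℝ → Y := fun t =>
    if h : (x t, w.1.2) ∈ N.AB.domain then N.CD ⟨(x t, w.1.2), h⟩ else 0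
  have hy : ∀ t (h : (x t, w.1.2) ∈ N.AB.domain), y t = N.CD ⟨(x t, w.1.2), h⟩ :=
    fun t h => dif_pos h
  have hxc : Continuous x := continuous_iff_continuousAt.2 fun t => (hx t).continuousAt
  refine ⟨x, fun _ => w.1.2, y, ⟨?_, continuousOn_const, ?_, ?_⟩, ?_⟩
  · refine ContDiff.contDiffOn (contDiff_one_iff_deriv.2 ⟨fun t => (hx t).differentiableAt, ?_⟩)
    rw [funext fun t => (hx t).deriv]
    exact G.continuous_orbit b
  -- The graph norm of the difference of two points of the curve involves only `x` and the orbit of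
  -- `b`, both continuous, so boundedness of `C&D` gives continuity of the output.
  · obtain ⟨c, hc⟩ := N.bounded
    intro t ht
    obtain ⟨hdt, hAt⟩ := hmem t ht.1
    have hlim : Tendsto (fun s => c * Real.sqrt (‖x s - x t‖ ^ 2 + ‖w.1.2 - w.1.2‖ ^ 2 +
        ‖G.orbit b s - G.orbit b t‖ ^ 2)) (𝓝[Icc 0 T] t) (𝓝 0) := by
      have hcont : Continuous fun s => c * Real.sqrt (‖x s - x t‖ ^ 2 + ‖w.1.2 - w.1.2‖ ^ 2 +
          ‖G.orbit b s - G.orbit b t‖ ^ 2) := by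
        have := G.continuous_orbit b
        fun_prop
      have := hcont.tendsto t
      simp only [sub_self, norm_zero] at this
      simpa using this.mono_left nhdsWithin_le_nhds
    rw [ContinuousWithinAt, tendsto_iff_norm_sub_tendsto_zero]
    refine squeeze_zero' (Eventually.of_forall fun _ => norm_nonneg _) ?_ hlim
    filter_upwards [self_mem_nhdsWithin] with s hs
    obtain ⟨hds, hAs⟩ := hmem s hs.1
    rw [hy t hdt, hy s hds, ← hAs, ← hAt]
    exact norm_CD_sub_le hc _ _
  · intro t ht
    obtain ⟨hd, hA⟩ := hmem t ht.1
    exact ⟨hd, hA ▸ (hx t).hasDerivWithinAt, hy t hd⟩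
  · simp [x, z]

theorem IsDissipative.V_le_dom [CompleteSpace X]
    {N : SystemNode X U Y} {s : Y → U → ℝ} {St : RealQuadraticForm X}
    (h : N.IsDissipative s St) : N.V ≤ St.dom := by
  rintro _ ⟨w, hw, rfl⟩
  obtain ⟨x, u, y, htraj, h0⟩ := N.exists_isClassicalTrajectory 1 ⟨w, hw⟩
  have := (h 1 one_pos x u y htraj).1
  rwa [h0] at this

/-- By the closed graph theorem, the projection of the graph of `A&B` to the state space is
bounded as a map into the domain of a closed form. -/
theorem exists_clm_graph [CompleteSpace X] [CompleteSpace U] (N : SystemNode X U Y)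
    {St : RealQuadraticForm X} (hV : N.V ≤ St.dom) (n : St.FormNorm) [CompleteSpace n.Space] :
    ∃ J : N.AB.graph →L[ℂ] n.Space, ∀ w (hw : w.1.1.1 ∈ St.dom), J w = n.pt ⟨w.1.1.1, hw⟩ := by
  have hcl : IsClosed (N.AB.graph : Set ((X × U) × X)) := N.closed
  have : CompleteSpace N.AB.graph := hcl.completeSpace_coe
  have hmem : ∀ w : N.AB.graph, w.1.1.1 ∈ St.dom := fun w =>
    hV ⟨w.1.1, LinearPMap.mem_domain_of_mem_graph w.2, rfl⟩
  let f : N.AB.graph →ₗ[ℂ] St.dom :=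
    ((LinearMap.fst ℂ X U ∘ₗ LinearMap.fst ℂ (X × U) X) ∘ₗ N.AB.graph.subtype).codRestrict
      St.dom hmem
  let g : N.AB.graph →ₗ[ℂ] n.Space := f
  obtain ⟨c, hc⟩ := n.embed
  let ι : n.Space →L[ℂ] X := LinearMap.mkContinuous (show n.Space →ₗ[ℂ] X from St.dom.subtype) c hc
  -- The embedding `ι` carries the limit in the form norm to `X`, where it must agree with the state
  -- component of the limit in the graph.
  refine ⟨ContinuousLinearMap.ofSeqClosedGraph (g := g) fun v w z hv hz => ?_, fun w hw => rfl⟩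
  have h1 : Tendsto (fun k => (v k).1.1.1) atTop (𝓝 w.1.1.1) :=
    ((by fun_prop : Continuous fun w : N.AB.graph => w.1.1.1).tendsto w).comp hv
  have h2 : Tendsto (fun k => (v k).1.1.1) atTop (𝓝 (ι z)) := (ι.continuous.tendsto z).comp hz
  exact Subtype.ext (tendsto_nhds_unique h2 h1)

theorem norm_le_graphNorm (N : SystemNode X U Y) (w : N.AB.domain) :
    ‖((w : X × U), N.AB w)‖ ≤ graphNorm N.AB w := by
  refine max_le (max_le (norm_fst_le_graphNorm _ _) ?_) ?_
  · apply Real.le_sqrt_of_sq_le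
    nlinarith [sq_nonneg ‖w.1.1‖, sq_nonneg ‖N.AB w‖]
  · apply Real.le_sqrt_of_sq_le
    nlinarith [sq_nonneg ‖w.1.1‖, sq_nonneg ‖w.1.2‖]

/-- Bounding `J` at `(w, A&B w)` for all `w` over the same state and taking the infimum over the
inputs turns the graph norm into the norm of `V`. -/
theorem exists_formNorm_le [CompleteSpace X] [CompleteSpace U] (N : SystemNode X U Y)
    {St : RealQuadraticForm X} (hV : N.V ≤ St.dom) (n : St.FormNorm) [CompleteSpace n.Space] :
    ∃ K : ℝ, 0 ≤ K ∧ ∀ v : N.VSpace, n.norm ⟨v.val, hV v.val_mem⟩ ≤ K * ‖v‖ := by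
  obtain ⟨J, hJ⟩ := N.exists_clm_graph hV n
  -- The summand `1` keeps the constant positive, so that it can be divided out before passing to
  -- the infimum.
  refine ⟨‖J‖ + 1, by positivity, fun v => ?_⟩
  rw [← div_le_iff₀' (by positivity)]
  refine v.le_norm _ fun w hw => ?_
  rw [div_le_iff₀' (by positivity)]
  let p : N.AB.graph := ⟨(w, N.AB w), N.AB.mem_graph w⟩
  have hp : w.1.1 ∈ St.dom := hw ▸ hV v.val_mem
  have h1 : ‖J p‖ = n.norm ⟨v.val, hV v.val_mem⟩ := by
    rw [hJ p hp]
    change n.norm ⟨w.1.1, hp⟩ = _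
    congr 2
  rw [← h1]
  calc ‖J p‖ ≤ ‖J‖ * ‖p‖ := J.le_opNorm p
    _ ≤ (‖J‖ + 1) * graphNorm N.AB w := by
      gcongr
      · linarith
      · exact N.norm_le_graphNorm w

end SystemNode

/-! ### Differentiation of curves inside a closed subspace. -/

/-- A `C¹` curve with values in a closed subspace is `C¹` as a curve in the subspace. -/
theorem ContDiffOn.exists_codRestrict {E : Type*} [NormedAddCommGroup E] [NormedSpace ℂ E]
    {F : Submodule ℂ E} (hF : IsClosed (F : Set E)) {T : ℝ} (hT : 0 < T) {p : ℝ → E}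
    (hp : ContDiffOn ℝ 1 p (Icc 0 T)) (hmem : ∀ t ∈ Icc 0 T, p t ∈ F) :
    ∃ g g' : ℝ → F, (∀ t ∈ Icc 0 T, (g t : E) = p t) ∧
      (∀ t ∈ Icc 0 T, (g' t : E) = derivWithin p (Icc 0 T) t) ∧
      (∀ t ∈ Icc 0 T, HasDerivWithinAt g (g' t) (Icc 0 T) t) ∧ ContDiffOn ℝ 1 g (Icc 0 T) := by
  classical
  have hu := uniqueDiffOn_Icc hT
  have hd : ∀ t ∈ Icc 0 T, HasDerivWithinAt p (derivWithin p (Icc 0 T) t) (Icc 0 T) t :=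
    fun t ht => (hp.differentiableOn one_ne_zero t ht).hasDerivWithinAt
  -- Difference quotients lie in `F`, and `F` contains their limits.
  have hdmem : ∀ t ∈ Icc 0 T, derivWithin p (Icc 0 T) t ∈ F := by
    intro t ht
    have hne : (𝓝[Icc 0 T \ {t}] t).NeBot :=
      accPt_principal_iff_nhdsWithin.1 ((hu t ht).accPt)
    refine hF.mem_of_tendsto (hasDerivWithinAt_iff_tendsto_slope.1 (hd t ht)) ?_
    filter_upwards [self_mem_nhdsWithin] with s hs
    rw [slope_def_module, ← Complex.coe_smul]
    exact F.smul_mem _ (F.sub_mem (hmem s hs.1) (hmem t ht))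
  let lift : (ℝ → E) → ℝ → F := fun q t => if h : q t ∈ F then ⟨q t, h⟩ else 0
  have hlift : ∀ q : ℝ → E, ∀ t, q t ∈ F → (lift q t : E) = q t := fun q t h => by
    simp only [lift, dif_pos h]
  have hg := fun t ht => hlift p t (hmem t ht)
  have hg' := fun t ht => hlift (derivWithin p (Icc 0 T)) t (hdmem t ht)
  have hder : ∀ t ∈ Icc 0 T,
      HasDerivWithinAt (lift p) (lift (derivWithin p (Icc 0 T)) t) (Icc 0 T) t := by
    intro t ht
    -- The norm of `F` is that of `E`, so the remainder estimate transfers unchanged.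
    have h := hasDerivWithinAt_iff_isLittleO.1 (hd t ht)
    refine hasDerivWithinAt_iff_isLittleO.2 (Asymptotics.IsLittleO.of_norm_left ?_)
    refine (h.norm_left).congr' ?_ EventuallyEq.rfl
    filter_upwards [self_mem_nhdsWithin] with s hs
    rw [← hg s hs, ← hg t ht, ← hg' t ht]
    rfl
  refine ⟨lift p, lift (derivWithin p (Icc 0 T)), hg, hg', hder, ?_⟩
  rw [contDiffOn_one_iff_derivWithin hu]
  refine ⟨fun t ht => (hder t ht).differentiableWithinAt, ?_⟩
  have hc : ContinuousOn (lift (derivWithin p (Icc 0 T))) (Icc 0 T) := by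
    rw [Topology.IsInducing.subtypeVal.continuousOn_iff]
    exact (hp.continuousOn_derivWithin hu le_rfl).congr hg'
  exact hc.congr fun t ht => (hder t ht).derivWithin (hu t ht)

/-! ### The form as a bounded real-bilinear map. -/

namespace RealQuadraticForm.FormNorm

variable {X : Type*} [NormedAddCommGroup X] [InnerProductSpace ℂ X] {S : RealQuadraticForm X}

/-- By homogeneity `S(2x) = 4 S(x)`, and the imaginary terms cancel because `x + ix = i(x - ix)`. -/
theorem polarForm_self (n : S.FormNorm) (x : S.dom) : polarForm S.toFun x x = S.toFun x := by
  have h1 : S.toFun (x + x) = 4 * S.toFun x := by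
    have := n.toFun_smul 2 x
    rw [two_smul] at this
    rw [this]; norm_num
  have h2 : S.toFun (x - x) = 0 := by
    have := n.toFun_smul 0 x
    rw [zero_smul] at this
    rw [sub_self, this]; simp
  have h3 : S.toFun (x + Complex.I • x) = S.toFun (x - Complex.I • x) := by
    have := n.toFun_smul Complex.I (x - Complex.I • x)
    rw [smul_sub, smul_smul, Complex.I_mul_I, neg_one_smul, sub_neg_eq_add, add_comm] at this
    simpa using this
  rw [polarForm, h1, h2, h3]
  push_cast
  ring

variable {n : S.FormNorm} {P : n.Space →L[ℂ] (n.Space →L⋆[ℂ] ℂ)}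

theorem Represents.re_apply_self (hP : n.Represents P) (x : S.dom) :
    (P (n.pt x) (n.pt x)).re = S.toFun x := by
  have h := congrArg Complex.re (hP x x)
  rwa [n.polarForm_self, Complex.conj_re, Complex.ofReal_re, eq_comm] at h

theorem Represents.re_apply (hP : n.Represents P) (x z : S.dom) :
    (P (n.pt x) (n.pt z)).re = (polarForm S.toFun x z).re := by
  rw [n.polarForm_conj, hP z x, Complex.conj_conj]

theorem Represents.re_symm (hP : n.Represents P) (x z : n.Space) :
    (P x z).re = (P z x).re := by
  have h := congrArg Complex.re (n.polarForm_conj x z)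
  rw [Complex.conj_re] at h
  exact (hP.re_apply x z).trans (h.trans (hP.re_apply z x).symm)

/-- `P` is conjugate linear in its second argument, so bilinearity holds only over `ℝ`. This is
enough for continuity, smoothness and the product rule along curves of a real variable. -/
theorem isBoundedBilinearMap_re (P : n.Space →L[ℂ] (n.Space →L⋆[ℂ] ℂ)) :
    IsBoundedBilinearMap ℝ fun q : n.Space × n.Space => (P q.1 q.2).re where
  add_left x₁ x₂ z := by simp
  smul_left c x z := by
    rw [← Complex.coe_smul c x]
    simp
  add_right x z₁ z₂ := by simp
  smul_right c x z := by
    change (P x ((c : ℂ) • z)).re = c • (P x z).re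
    rw [(P x).map_smulₛₗ, Complex.conj_ofReal, Complex.coe_smul, Complex.smul_re]
  bound := by
    refine ⟨‖P‖ + 1, by positivity, fun x z => ?_⟩
    calc ‖(P x z).re‖ ≤ ‖P x z‖ := Complex.abs_re_le_norm _
      _ ≤ ‖P x‖ * ‖z‖ := (P x).le_opNorm z
      _ ≤ (‖P‖ + 1) * ‖x‖ * ‖z‖ := by
        gcongr
        exact (P.le_opNorm x).trans (by gcongr; linarith)

end RealQuadraticForm.FormNorm

theorem RealQuadraticForm.value_of_mem {X : Type*} [NormedAddCommGroup X] [InnerProductSpace ℂ X]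
    (S : RealQuadraticForm X) {x : X} (hx : x ∈ S.dom) : S.value x = S.toFun ⟨x, hx⟩ :=
  dif_pos hx

/-! ### The storage function along trajectories. -/

namespace SystemNode

variable {X U Y : Type*}
  [NormedAddCommGroup X] [InnerProductSpace ℂ X]
  [NormedAddCommGroup U] [InnerProductSpace ℂ U]
  [NormedAddCommGroup Y] [InnerProductSpace ℂ Y]
  {N : SystemNode X U Y} {T : ℝ} {x : ℝ → X} {u : ℝ → U} {y : ℝ → Y}

theorem IsClassicalTrajectory.mem_V (h : N.IsClassicalTrajectory T x u y) {t : ℝ}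
    (ht : t ∈ Icc 0 T) : x t ∈ N.V :=
  ⟨(x t, u t), (h.equation t ht).1, rfl⟩

theorem IsClassicalTrajectory.mem_graph (h : N.IsClassicalTrajectory T x u y) (hT : 0 < T) {t : ℝ}
    (ht : t ∈ Icc 0 T) : ((x t, u t), derivWithin x (Icc 0 T) t) ∈ N.AB.graph := by
  obtain ⟨hw, hd, -⟩ := h.equation t ht
  rw [hd.derivWithin (uniqueDiffOn_Icc hT t ht)]
  exact N.AB.mem_graph ⟨_, hw⟩

variable [CompleteSpace X] [CompleteSpace U]

/-- The values of `P` are conjugates of the polar form, which does not depend on the chosen form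
norm. Boundedness on `V` is therefore proved with the complete norm `n₀` and serves any `n`, so the
equivalence of the two norms need not be established. -/
theorem exists_restrict_V (N : SystemNode X U Y) {St : RealQuadraticForm X} (hV : N.V ≤ St.dom)
    (n₀ : St.FormNorm) [CompleteSpace n₀.Space] (n : St.FormNorm)
    {P : n.Space →L[ℂ] (n.Space →L⋆[ℂ] ℂ)} (hP : n.Represents P) :
    ∃ PV : N.VSpace →L[ℂ] (N.VSpace →L⋆[ℂ] ℂ), ∀ v w : N.VSpace,
      PV v w = P (n.pt ⟨v.val, hV v.val_mem⟩) (n.pt ⟨w.val, hV w.val_mem⟩) := by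
  obtain ⟨K, hK, hKn⟩ := N.exists_formNorm_le hV n₀
  obtain ⟨C, hC⟩ := n₀.norm_polarForm_le
  let j : N.VSpace →ₗ[ℂ] n.Space := Submodule.inclusion hV
  let B : N.VSpace →ₗ[ℂ] N.VSpace →ₗ⋆[ℂ] ℂ := LinearMap.mk₂'ₛₗ (RingHom.id ℂ) (starRingEnd ℂ)
    (fun v w => P (j v) (j w)) (fun v v' w => by simp) (fun c v w => by simp)
    (fun v w w' => by simp) (fun c v w => by simp)
  refine ⟨B.mkContinuous₂ (|C| * K * K) fun v w => ?_, fun v w => rfl⟩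
  have h := hP ⟨w.val, hV w.val_mem⟩ ⟨v.val, hV v.val_mem⟩
  have hB : ‖B v w‖ = ‖polarForm St.toFun ⟨w.val, hV w.val_mem⟩ ⟨v.val, hV v.val_mem⟩‖ := by
    rw [h, RCLike.norm_conj]
    rfl
  rw [hB]
  calc _ ≤ C * n₀.norm ⟨w.val, hV w.val_mem⟩ * n₀.norm ⟨v.val, hV v.val_mem⟩ := hC _ _
    _ ≤ |C| * (K * ‖w‖) * (K * ‖v‖) := by
      gcongr
      · exact le_abs_self C
      · exact hKn w
      · exact hKn v
    _ = |C| * K * K * ‖v‖ * ‖w‖ := by ring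

theorem IsClassicalTrajectory.continuousOn_value (h : N.IsClassicalTrajectory T x u y)
    (hT : 0 < T) {St : RealQuadraticForm X} (hV : N.V ≤ St.dom) (n : St.FormNorm)
    [CompleteSpace n.Space] : ContinuousOn (fun t => St.value (x t)) (Icc 0 T) := by
  obtain ⟨J, hJ⟩ := N.exists_clm_graph hV n
  obtain ⟨P, hP, -⟩ := n.existsUnique_represents
  have hp : ContinuousOn (fun t => ((x t, u t), derivWithin x (Icc 0 T) t)) (Icc 0 T) :=
    (h.contDiffOn_state.continuousOn.prodMk h.continuousOn_input).prodMk
      (h.contDiffOn_state.continuousOn_derivWithin (uniqueDiffOn_Icc hT) le_rfl)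
  -- The curve is known to lie in the graph only for times in `[0, T]`, so it is lifted on that
  -- subtype.
  rw [continuousOn_iff_continuous_domRestrict] at hp ⊢
  have hg : Continuous fun t : Icc 0 T => (⟨_, h.mem_graph hT t.2⟩ : N.AB.graph) :=
    hp.subtype_mk _
  have hJg := J.continuous.comp hg
  refine ((RealQuadraticForm.FormNorm.isBoundedBilinearMap_re P).continuous.comp (hJg.prodMk hJg)).congr fun t => ?_
  have hx := hV (h.mem_V t.2)
  change (P (J _) (J _)).re = St.value (x t)
  rw [hJ _ hx, hP.re_apply_self, St.value_of_mem hx]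

theorem IsClassicalTrajectory.contDiffOn_value (h : N.IsClassicalTrajectory T x u y)
    (hT : 0 < T) {St : RealQuadraticForm X} (hV : N.V ≤ St.dom) (n : St.FormNorm)
    [CompleteSpace n.Space] (hx : ContDiffOn ℝ 2 x (Icc 0 T)) (hu : ContDiffOn ℝ 1 u (Icc 0 T)) :
    ContDiffOn ℝ 1 (fun t => St.value (x t)) (Icc 0 T) ∧
      ∀ t (ht : t ∈ Icc 0 T), ∃ (hw : (x t, u t) ∈ N.AB.domain)
        (hAB : N.AB ⟨(x t, u t), hw⟩ ∈ N.V),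
        HasDerivWithinAt (fun τ => St.value (x τ))
          (2 * (polarForm St.toFun ⟨x t, hV (h.mem_V ht)⟩ ⟨_, hV hAB⟩).re) (Icc 0 T) t := by
  obtain ⟨J, hJ⟩ := N.exists_clm_graph hV n
  obtain ⟨P, hP, -⟩ := n.existsUnique_represents
  have hud := uniqueDiffOn_Icc hT
  have hx' : ContDiffOn ℝ 1 (derivWithin x (Icc 0 T)) (Icc 0 T) := hx.derivWithin hud (by norm_num)
  have hp : ContDiffOn ℝ 1 (fun t => ((x t, u t), derivWithin x (Icc 0 T) t)) (Icc 0 T) :=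
    (h.contDiffOn_state.prodMk hu).prodMk hx'
  obtain ⟨g, g', hg, hg', hder, hcd⟩ :=
    hp.exists_codRestrict N.closed hT fun t ht => h.mem_graph hT ht
  let Jr : N.AB.graph →L[ℝ] n.Space := J.restrictScalars ℝ
  have hval : ∀ t ∈ Icc 0 T, St.value (x t) = (P (Jr (g t)) (Jr (g t))).re := by
    intro t ht
    have hxt : (g t).1.1.1 = x t := by rw [hg t ht]
    have hm := hV (h.mem_V ht)
    have hm' : (g t).1.1.1 ∈ St.dom := hxt ▸ hm
    change _ = (P (J _) (J _)).re
    rw [hJ _ hm', hP.re_apply_self, ← St.value_of_mem hm', hxt]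
  have hbil := RealQuadraticForm.FormNorm.isBoundedBilinearMap_re P
  have hJg : ContDiffOn ℝ 1 (fun t => Jr (g t)) (Icc 0 T) := Jr.contDiff.comp_contDiffOn hcd
  refine ⟨(hbil.contDiff.comp_contDiffOn (hJg.prodMk hJg)).congr hval, fun t ht => ?_⟩
  obtain ⟨hw, hd, -⟩ := h.equation t ht
  have hxt : (g t).1.1.1 = x t := by rw [hg t ht]
  -- The state component of the derivative of the lifted curve is the derivative of `x`. As `g' t`
  -- belongs to the graph, this places `A&B(x, u)` in `V`.
  have hg't : (g' t).1.1.1 = N.AB ⟨(x t, u t), hw⟩ := by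
    have h1 : HasDerivWithinAt (fun t => ((x t, u t), derivWithin x (Icc 0 T) t))
        (g' t).1 (Icc 0 T) t := by
      rw [hg' t ht]
      exact (hp.differentiableOn one_ne_zero t ht).hasDerivWithinAt
    exact (hud t ht).eq_deriv _ h1.fst.fst hd
  have hAB : N.AB ⟨(x t, u t), hw⟩ ∈ N.V :=
    ⟨(g' t).1.1, LinearPMap.mem_domain_of_mem_graph (g' t).2, hg't⟩
  refine ⟨hw, hAB, ?_⟩
  have hγ : HasDerivWithinAt (fun τ => Jr (g τ)) (Jr (g' t)) (Icc 0 T) t :=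
    Jr.hasFDerivAt.comp_hasDerivWithinAt t (hder t ht)
  have hmain := (hbil.hasFDerivAt (Jr (g t), Jr (g t))).comp_hasDerivWithinAt t (hγ.prodMk hγ)
  refine (hmain.congr hval (hval t ht)).congr_deriv ?_
  have e1 : Jr (g t) = n.pt ⟨x t, hV (h.mem_V ht)⟩ :=
    (hJ (g t) (hxt ▸ hV (h.mem_V ht))).trans (congrArg n.pt (Subtype.ext hxt))
  have e2 : Jr (g' t) = n.pt ⟨_, hV hAB⟩ :=
    (hJ (g' t) (hg't ▸ hV hAB)).trans (congrArg n.pt (Subtype.ext hg't))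
  rw [← hP.re_apply, ← e1, ← e2]
  change (P (Jr (g t)) (Jr (g' t))).re + (P (Jr (g' t)) (Jr (g t))).re = _
  rw [hP.re_symm (Jr (g' t)), two_mul]

end SystemNode

theorem proposition3p3 {X U Y : Type*}
    [NormedAddCommGroup X] [InnerProductSpace ℂ X] [CompleteSpace X]
    [NormedAddCommGroup U] [InnerProductSpace ℂ U] [CompleteSpace U]
    [NormedAddCommGroup Y] [InnerProductSpace ℂ Y] [CompleteSpace Y]
    (N : SystemNode X U Y)
    (Q : Y →L[ℂ] Y) (S : U →L[ℂ] Y) (R : U →L[ℂ] U)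
    (hQ : IsSelfAdjoint Q) (hR : IsSelfAdjoint R)
    (St : RealQuadraticForm X)
    (hdense : Dense (St.dom : Set X)) (hclosed : St.IsClosedSemibounded)
    (hdiss : N.IsDissipative (supplyRate Q S R) St)
    (T : ℝ) (hT : 0 < T) (x : ℝ → X) (u : ℝ → U) (y : ℝ → Y)
    (htraj : N.IsClassicalTrajectory T x u y) :
    (∀ t ∈ Icc 0 T, x t ∈ St.dom) ∧
    ContinuousOn (fun t => St.value (x t)) (Icc 0 T) ∧
    (ContDiffOn ℝ 2 x (Icc 0 T) → ContDiffOn ℝ 1 u (Icc 0 T) →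
      ContDiffOn ℝ 1 (fun t => St.value (x t)) (Icc 0 T) ∧
      ∀ (n : St.FormNorm) (P : n.Space →L[ℂ] (n.Space →L⋆[ℂ] ℂ)), n.Represents P →
        ∃ PV : N.VSpace →L[ℂ] (N.VSpace →L⋆[ℂ] ℂ),
          (∃ hV : N.V ≤ St.dom, ∀ v w : N.VSpace,
            PV v w = P (n.pt ⟨v.val, hV v.val_mem⟩) (n.pt ⟨w.val, hV w.val_mem⟩)) ∧
          ∀ t ∈ Icc 0 T, ∃ (hx : x t ∈ N.V) (hw : (x t, u t) ∈ N.AB.domain)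
            (hAB : N.AB ⟨(x t, u t), hw⟩ ∈ N.V),
            HasDerivWithinAt (fun τ => St.value (x τ))
              (2 * (PV (SystemNode.VSpace.mk (x t) hx)
                (SystemNode.VSpace.mk (N.AB ⟨(x t, u t), hw⟩) hAB)).re)
              (Icc 0 T) t) := by
  have hV := hdiss.V_le_dom
  obtain ⟨n₀, hn₀⟩ := hclosed
  refine ⟨fun t ht => hV (htraj.mem_V ht), htraj.continuousOn_value hT hV n₀, fun hx hu => ?_⟩
  obtain ⟨hC, hder⟩ := htraj.contDiffOn_value hT hV n₀ hx hu
  refine ⟨hC, fun n P hP => ?_⟩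
  obtain ⟨PV, hPV⟩ := N.exists_restrict_V hV n₀ n hP
  refine ⟨PV, ⟨hV, hPV⟩, fun t ht => ?_⟩
  obtain ⟨hw, hAB, hd⟩ := hder t ht
  refine ⟨htraj.mem_V ht, hw, hAB, hd.congr_deriv ?_⟩
  rw [hPV, ← hP.re_apply]
  rfl
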